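/- Let $\mathbb{K}\in\{\mathbb{R},\mathbb{C}\}$, let $Y$ be a Banach space over $\mathbb{K}$, and let $(\Omega,\Sigma,\mu)$ be a $\sigma$-finite measure space with $\dim L_1(\mu)\ge 2$, where $L_1(\mu)$ is the space of $\mathbb{K}$-valued integrable functions. For Banach spaces $X,Y$ let $\mathcal{L}(X,Y)$ be the space of bounded linear operators from $X$ to $Y$. An operator $T\in\mathcal{L}(X,Y)$ is *range strongly exposing* if there is $x_0\in X$ with $\|x_0\|=1$ such that every sequence $(x_n)$ in the closed unit ball of $X$ with $\|Tx_n\|\to\|T\|$ has a subsequence $(x_{\sigma(n)})$ with $Tx_{\sigma(n)}\to\lambda Tx_0$ for some $\lambda\in\mathbb{K}$, $|\lambda|=1$. A set $\mathcal{M}\subseteq\mathcal{L}(X,Y)$ has the *BPBp-RSE* (Bishop–Phelps–Bollobás property for range strongly exposing operators) if for every $\varepsilon>0$ there is $0<\eta<\varepsilon$ such that for all $T\in\mathcal{M}$ with $\|T\|=1$ and all $x\in X$ with $\|x\|=1$ and $\|Tx\|>1-\eta$ there are a range strongly exposing operator $S\in\mathcal{M}$ and $x_0\in X$ with $$\|x_0\|=\|S\|=\|Sx_0\|=1,\qquad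 \|S-T\|<\varepsilon,\qquad \|x-x_0\|<\varepsilon .$$ An operator $T\in\mathcal{L}(X,Y)$ is a *Radon–Nikodým operator* if for every finite measure space $(\Omega',\Sigma',\nu)$ and every $\nu$-continuous countably additive vector measure $G\colon\Sigma'\to X$ of bounded variation there is a Bochner $\nu$-integrable $f\colon\Omega'\to Y$ with $T(G(A))=\int_A f\,d\nu$ for all $A\in\Sigma'$. A Banach space $Y$ is *uniformly convex* if for every $\varepsilon>0$ there is $\delta>0$ such that $\|y_1+y_2\|\le 2-\delta$ whenever $\|y_1\|=\|y_2\|=1$ and $\|y_1-y_2\|\ge\varepsilon$. Then the following are equivalent: 1. the set of finite-rank operators in $\mathcal{L}(L_1(\mu),Y)$ has the BPBp-RSE; 2. the set of compact operators in $\mathcal{L}(L_1(\mu),Y)$ has the BPBp-RSE; 3. the set of weakly compact operators in $\mathcal{L}(L_1(\mu),Y)$ has the BPBp-RSE; 4. the set of Radon–Nikodým operators in $\mathcal{L}(L_1(\mu),Y)$ has the BPBp-RSE; 5. $\mathcal{L}(L_1(\mu),Y)$ has the BPBp-RSE; 6. $Y$ is uniformly convex. -/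

import Mathlib

open MeasureTheory Filter Topology

universe u v w z

section Operators

variable {𝕜 : Type z} [RCLike 𝕜]
  {X : Type v} [NormedAddCommGroup X] [NormedSpace 𝕜 X]
  {Y : Type u} [NormedAddCommGroup Y] [NormedSpace 𝕜 Y]

/-- `T` is range strongly exposing: there is a norm-one `x₀` such that every sequence in the closed
unit ball along which `‖T xₙ‖ → ‖T‖` has a subsequence whose images converge to a rotation
of `T x₀`. -/
def IsRangeStronglyExposing (T : X →L[𝕜] Y) : Prop :=
  ∃ x₀ : X, ‖x₀‖ = 1 ∧
    ∀ x : ℕ → X, (∀ n, ‖x n‖ ≤ 1) → Tendsto (fun n => ‖T (x n)‖) atTop (𝓝 ‖T‖) →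
      ∃ φ : ℕ → ℕ, StrictMono φ ∧ ∃ c : 𝕜, ‖c‖ = 1 ∧
        Tendsto (fun n => T (x (φ n))) atTop (𝓝 (c • T x₀))

/-- The Bishop–Phelps–Bollobás property for range strongly exposing operators of a class `M` of
bounded operators from `X` to `Y`. -/
def HasBPBpRSE (M : Set (X →L[𝕜] Y)) : Prop :=
  ∀ ε : ℝ, 0 < ε → ∃ η : ℝ, 0 < η ∧ η < ε ∧
    ∀ T ∈ M, ‖T‖ = 1 → ∀ x : X, ‖x‖ = 1 → 1 - η < ‖T x‖ →
      ∃ S ∈ M, IsRangeStronglyExposing S ∧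
        ∃ x₀ : X, ‖x₀‖ = 1 ∧ ‖S‖ = 1 ∧ ‖S x₀‖ = 1 ∧ ‖S - T‖ < ε ∧ ‖x - x₀‖ < ε

/-- `T` has finite-dimensional range. -/
def IsFiniteRankOperator (T : X →L[𝕜] Y) : Prop :=
  FiniteDimensional 𝕜 (LinearMap.range (T : X →ₗ[𝕜] Y))

/-- `T` maps the closed unit ball to a relatively weakly compact set. -/
def IsWeaklyCompactOperator (T : X →L[𝕜] Y) : Prop :=
  IsCompact (closure (toWeakSpace 𝕜 Y '' (T '' Metric.closedBall (0 : X) 1)))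

/-- `T` is a Radon–Nikodým operator: for every finite measure space `(Ω, Σ, ν)` and every
`ν`-continuous vector measure `G : Σ → X` of bounded variation, the vector measure `T ∘ G` has a
Bochner integrable density with respect to `ν`. The Bochner integral in `Y` refers to the real
normed space underlying `Y`. -/
def IsRadonNikodymOperator (T : X →L[𝕜] Y) : Prop :=
  letI : NormedSpace ℝ Y := NormedSpace.restrictScalars ℝ 𝕜 Y
  ∀ (Ω : Type w) [MeasurableSpace Ω] (ν : Measure Ω) [IsFiniteMeasure ν] (G : VectorMeasure Ω X),
    G.variation Set.univ < ⊤ → (∀ s, MeasurableSet s → ν s = 0 → G s = 0) →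
      ∃ f : Ω → Y, Integrable f ν ∧ ∀ s, MeasurableSet s → T (G s) = ∫ ω in s, f ω ∂ν

end Operators

/-! Both directions use only that a class contains `0` and is stable under `T ↦ a • T ∘ Q + ψ ⊗ y`
(`IsStableClass`). All five classes are stable, so each of statements 1–5 is separately equivalent
to uniform convexity.

Necessity (`uniformConvexSpace_of_hasBPBpRSE`): split `L¹` over two disjoint non-null sets, and let
`T` send normalized indicators `e₁, e₂` to unit vectors `y₁, y₂` with `‖y₁ + y₂‖` near 2. Then `T`
almost attains its norm at `(e₁ + e₂) / 2`. A nearby range strongly exposing `S` attains its norm at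
a nearby `x₀`, hence on both pieces of `x₀`, whose images are then multiples of one vector `w`. So
`y₁, y₂` are close to rotations of `w`, and these rotations nearly agree because `‖y₁ + y₂‖` is near
2.

Sufficiency (`exists_rank_one_approximation`): if `‖T x‖` is near 1, a Hahn decomposition gives a
set `A` carrying most of `x` such that the normalized images of all restrictions of `x` within `A`
lie in one slice of the ball of `Y`. By uniform convexity the slice is small, so `T` on `L¹(A)` is
close to `ψ ⊗ y`. Using `ψ ⊗ y` on `A` and shrinking `T` slightly off `A` gives `S`. -/

/-! ### Range strongly exposing operators and `ℓ¹`-decompositions -/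

section LDecomposition

variable {𝕜 : Type*} [RCLike 𝕜]
  {X : Type*} [NormedAddCommGroup X] [NormedSpace 𝕜 X]
  {Y : Type*} [NormedAddCommGroup Y] [NormedSpace 𝕜 Y]

/-- `P` and `Q` are complementary operators splitting the norm as an `ℓ¹` sum. -/
structure IsLDecomposition (P Q : X →L[𝕜] X) : Prop where
  add_apply : ∀ f, P f + Q f = f
  norm_add_norm : ∀ f, ‖P f‖ + ‖Q f‖ = ‖f‖

/-- A set of operators containing `0` and stable under right composition with bounded operators,
scalar multiples and rank-one perturbations. -/
structure IsStableClass (M : Set (X →L[𝕜] Y)) : Prop where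
  zero_mem : 0 ∈ M
  smul_comp_add_mem : ∀ T ∈ M, ∀ (a : 𝕜) (Q : X →L[𝕜] X) (ψ : X →L[𝕜] 𝕜) (y : Y),
    a • T.comp Q + ψ.smulRight y ∈ M

/-- The factor `1 - κ` penalizes mass in `Q`: `‖S f‖ ≤ ‖f‖ - κ ‖Q f‖`. Along a norming sequence the
`Q`-parts therefore vanish, `S` behaves like `ψ ⊗ y`, and compactness of the scalar ball supplies
the rotation of `y = S x₀`. -/
lemma isRangeStronglyExposing_of_isLDecomposition {P Q : X →L[𝕜] X} (hPQ : IsLDecomposition P Q)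
    {T : X →L[𝕜] Y} (hT : ‖T‖ ≤ 1) {κ : ℝ} (hκ : 0 < κ) (hκ1 : κ ≤ 1) {ψ : X →L[𝕜] 𝕜}
    (hψ : ∀ f, ‖ψ f‖ ≤ ‖P f‖) {y : Y} (hy : ‖y‖ = 1) {x₀ : X} (hx₀ : ‖x₀‖ = 1) (hP : P x₀ = x₀)
    (hψx : ψ x₀ = 1) {S : X →L[𝕜] Y} (hS : S = ((1 - κ : ℝ) : 𝕜) • T.comp Q + ψ.smulRight y) :
    IsRangeStronglyExposing S ∧ ‖S‖ = 1 ∧ ‖S x₀‖ = 1 := by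
  have hSf : ∀ f, S f = ((1 - κ : ℝ) : 𝕜) • T (Q f) + ψ f • y := by
    intro f; simp [hS]
  have hTQ : ∀ f, ‖((1 - κ : ℝ) : 𝕜) • T (Q f)‖ ≤ (1 - κ) * ‖Q f‖ := by
    intro f
    rw [norm_smul, RCLike.norm_ofReal, abs_of_nonneg (by linarith)]
    have := T.le_of_opNorm_le hT (Q f)
    exact mul_le_mul_of_nonneg_left (by linarith) (by linarith)
  have hψy : ∀ f, ‖ψ f • y‖ = ‖ψ f‖ := by intro f; rw [norm_smul, hy, mul_one]
  have hbound : ∀ f, ‖S f‖ ≤ (1 - κ) * ‖Q f‖ + ‖ψ f‖ := by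
    intro f
    rw [hSf]
    exact (norm_add_le _ _).trans (add_le_add (hTQ f) (hψy f).le)
  have hQx : Q x₀ = 0 := by
    have := hPQ.add_apply x₀
    rwa [hP, add_eq_left] at this
  have hSx : S x₀ = y := by simp [hSf, hQx, hψx]
  have hS1 : ‖S‖ = 1 := by
    apply le_antisymm
    · refine S.opNorm_le_bound zero_le_one fun f => ?_
      have h1 := hbound f
      have h2 := hPQ.norm_add_norm f
      have h3 := hψ f
      nlinarith [norm_nonneg (Q f)]
    · have := S.le_opNorm x₀
      rwa [hSx, hy, hx₀, mul_one] at this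
  refine ⟨⟨x₀, hx₀, fun x hx hlim => ?_⟩, hS1, by rw [hSx, hy]⟩
  rw [hS1] at hlim
  have hψQ : ∀ n, ‖ψ (x n)‖ ≤ 1 - ‖Q (x n)‖ := fun n => by
    linarith [hψ (x n), hPQ.norm_add_norm (x n), hx n]
  have hQ0 : Tendsto (fun n => ‖Q (x n)‖) atTop (𝓝 0) := by
    have h1 : Tendsto (fun n => (1 - ‖S (x n)‖) / κ) atTop (𝓝 0) := by
      have := (hlim.const_sub 1).div_const κ
      simpa using this
    refine squeeze_zero (fun n => norm_nonneg _) (fun n => ?_) h1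
    rw [le_div_iff₀ hκ]
    nlinarith [hbound (x n), hψQ n]
  have hψ1 : Tendsto (fun n => ‖ψ (x n)‖) atTop (𝓝 1) := by
    have h1 : Tendsto (fun n => ‖S (x n)‖ - (1 - κ) * ‖Q (x n)‖) atTop (𝓝 1) := by
      simpa using hlim.sub (hQ0.const_mul (1 - κ))
    refine tendsto_of_tendsto_of_tendsto_of_le_of_le h1 tendsto_const_nhds
      (fun n => ?_) (fun n => ?_)
    · simpa using by linarith [hbound (x n)]
    · simpa using by linarith [hψQ n, norm_nonneg (Q (x n))]
  obtain ⟨c, -, φ, hφ, hc⟩ := (isCompact_closedBall (0 : 𝕜) 1).tendsto_subseq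
    (x := fun n => ψ (x n)) (fun n => by
      simpa using by linarith [hψQ n, norm_nonneg (Q (x n))])
  refine ⟨φ, hφ, c, ?_, ?_⟩
  · exact tendsto_nhds_unique hc.norm (hψ1.comp hφ.tendsto_atTop)
  · rw [hSx]
    have hTQ0 : Tendsto (fun n => ((1 - κ : ℝ) : 𝕜) • T (Q (x n))) atTop (𝓝 0) := by
      refine squeeze_zero_norm (fun n => hTQ (x n)) ?_
      simpa using hQ0.const_mul (1 - κ)
    simpa [hSf] using (hTQ0.comp hφ.tendsto_atTop).add (hc.smul_const y)

/-- A constant sequence at a normalized norm-attaining vector is already a norming sequence, so its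
image must equal a rotation of the exposed value. -/
lemma IsRangeStronglyExposing.exists_forall_eq_smul {S : X →L[𝕜] Y}
    (hS : IsRangeStronglyExposing S) (hS1 : ‖S‖ = 1) :
    ∃ z : X, ‖z‖ = 1 ∧ ∀ f, ‖S f‖ = ‖f‖ → ∃ c : 𝕜, ‖c‖ = 1 ∧ S f = ((‖f‖ : 𝕜) * c) • S z := by
  obtain ⟨z, hz, H⟩ := hS
  refine ⟨z, hz, fun f hf => ?_⟩
  rcases eq_or_ne f 0 with rfl | hf0
  · exact ⟨1, by simp, by simp⟩
  have hn : ‖f‖ ≠ 0 := norm_ne_zero_iff.2 hf0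
  have hnk : (‖f‖ : 𝕜) ≠ 0 := by exact_mod_cast hn
  obtain ⟨φ, -, c, hc, hlim⟩ := H (fun _ => ((‖f‖ : 𝕜)⁻¹) • f)
    (fun _ => by simp [norm_smul, hn])
    (by simp [norm_smul, hf, hn, hS1])
  refine ⟨c, hc, ?_⟩
  have := tendsto_nhds_unique tendsto_const_nhds hlim
  rw [mul_smul, ← this, map_smul, smul_inv_smul₀ hnk]

lemma norm_sub_sq_le_of_norm_add_ge {c d : 𝕜} (hc : ‖c‖ = 1) (hd : ‖d‖ = 1) {t : ℝ}
    (ht0 : 0 ≤ t) (ht : 2 - t ≤ ‖c + d‖) : ‖c - d‖ ^ 2 ≤ 4 * t := by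
  have h := parallelogram_law_with_norm 𝕜 c d
  rw [hc, hd] at h
  -- For `t > 2` the lower bound `2 - t` is negative and cannot be squared, but then `‖c - d‖² ≤ 4`
  -- suffices.
  rcases le_total t 2 with h2 | h2
  · nlinarith [norm_nonneg (c + d)]
  · nlinarith [norm_nonneg (c + d), norm_nonneg (c - d)]

/-- If `S` is close to `T` and maps a vector `u` close to `e / 2` to a multiple of `w`, then `T e`
is close to a rotation of `w`. -/
lemma norm_apply_sub_smul_le {S T : X →L[𝕜] Y} (hT1 : ‖T‖ ≤ 1) {ε : ℝ} (hST : ‖S - T‖ ≤ ε)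
    {e u : X} {w : Y} (he : ‖e‖ = 1) (hu : ‖u‖ ≤ 1) (hw : ‖w‖ ≤ 1)
    (heu : ‖(2⁻¹ : 𝕜) • e - u‖ ≤ ε) {c : 𝕜} (hc : ‖c‖ = 1) (hSu : S u = ((‖u‖ : 𝕜) * c) • w) :
    ‖T e - c • w‖ ≤ 6 * ε := by
  have h2 : |‖u‖ - 2⁻¹| ≤ ε := by
    have h3 : ‖(2⁻¹ : 𝕜) • e‖ = 2⁻¹ := by rw [norm_smul, he]; simp
    rw [← h3, abs_sub_comm]
    exact (abs_norm_sub_norm_le _ _).trans heu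
  -- Three errors of size `ε`: moving `e / 2` to `u`, replacing `T` by `S`, and replacing `‖u‖` by
  -- `1 / 2`. Doubling gives `6 * ε`.
  have h5 : ‖(2⁻¹ : 𝕜) • T e - ((2⁻¹ : 𝕜) * c) • w‖ ≤ 3 * ε := by
    have hsplit : (2⁻¹ : 𝕜) • T e - ((2⁻¹ : 𝕜) * c) • w =
        T ((2⁻¹ : 𝕜) • e - u) - (S - T) u + ((((‖u‖ - 2⁻¹ : ℝ) : 𝕜) * c) • w) := by
      rw [sub_apply, hSu, map_sub, map_smul]
      push_cast
      module
    rw [hsplit]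
    have a1 : ‖T ((2⁻¹ : 𝕜) • e - u)‖ ≤ ε := by
      have := T.le_of_opNorm_le hT1 ((2⁻¹ : 𝕜) • e - u)
      linarith
    have a2 : ‖(S - T) u‖ ≤ ε := by
      refine ((S - T).le_opNorm _).trans ?_
      nlinarith [norm_nonneg (S - T), norm_nonneg u]
    have a3 : ‖((((‖u‖ - 2⁻¹ : ℝ) : 𝕜) * c) • w)‖ ≤ ε := by
      rw [norm_smul, norm_mul, hc, mul_one, RCLike.norm_ofReal]
      nlinarith [abs_nonneg (‖u‖ - 2⁻¹), norm_nonneg w]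
    have a4 := norm_add_le (T ((2⁻¹ : 𝕜) • e - u) - (S - T) u)
      ((((‖u‖ - 2⁻¹ : ℝ) : 𝕜) * c) • w)
    have a5 := norm_sub_le (T ((2⁻¹ : 𝕜) • e - u)) ((S - T) u)
    linarith
  rw [mul_smul, ← smul_sub, norm_smul, norm_inv, RCLike.norm_two] at h5
  linarith

lemma norm_sub_lt_of_norm_sub_smul_le {y₁ y₂ w : Y} (hw : ‖w‖ ≤ 1) {c d : 𝕜} (hc : ‖c‖ = 1)
    (hd : ‖d‖ = 1) {e : ℝ} (he0 : 0 < e) (he1 : e ≤ 1)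
    (h₁ : ‖y₁ - c • w‖ ≤ 6 * (e ^ 2 / 500)) (h₂ : ‖y₂ - d • w‖ ≤ 6 * (e ^ 2 / 500))
    (h : 2 - 2 * (e ^ 2 / 500) ≤ ‖y₁ + y₂‖) : ‖y₁ - y₂‖ < e := by
  -- With `ε = e² / 500` the loss is `6ε + 6ε + 2ε`, so `‖c - d‖² ≤ 56 e² / 500 ≤ (e / 2)²`.
  have hcd : 2 - 14 * (e ^ 2 / 500) ≤ ‖c + d‖ := by
    have e1 : y₁ + y₂ = (y₁ - c • w) + (y₂ - d • w) + (c + d) • w := by module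
    have e2 : ‖y₁ + y₂‖ ≤ ‖y₁ - c • w‖ + ‖y₂ - d • w‖ + ‖(c + d) • w‖ := by
      conv_lhs => rw [e1]
      exact norm_add₃_le
    rw [norm_smul] at e2
    have := mul_le_of_le_one_right (norm_nonneg (c + d)) hw
    linarith
  have hsub := norm_sub_sq_le_of_norm_add_ge hc hd (by positivity) hcd
  have hsub' : ‖c - d‖ ≤ e / 2 := by
    refine abs_le_of_sq_le_sq' ?_ (by positivity) |>.2
    nlinarith [sq_nonneg e]
  have e1 : y₁ - y₂ = (y₁ - c • w) - (y₂ - d • w) + (c - d) • w := by module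
  have e2 : ‖y₁ - y₂‖ ≤ ‖y₁ - c • w‖ + ‖y₂ - d • w‖ + ‖(c - d) • w‖ := by
    conv_lhs => rw [e1]
    exact (norm_add_le _ _).trans (add_le_add_left (norm_sub_le _ _) _)
  rw [norm_smul] at e2
  have := mul_le_of_le_one_right (norm_nonneg (c - d)) hw
  nlinarith

theorem uniformConvexSpace_of_hasBPBpRSE {P Q : X →L[𝕜] X} (hPQ : IsLDecomposition P Q)
    {ψ₁ ψ₂ : X →L[𝕜] 𝕜} (hψ₁ : ∀ f, ‖ψ₁ f‖ ≤ ‖P f‖) (hψ₂ : ∀ f, ‖ψ₂ f‖ ≤ ‖Q f‖)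
    {e₁ e₂ : X} (he₁ : ‖e₁‖ = 1) (he₂ : ‖e₂‖ = 1) (hP : P e₁ = e₁) (hQ : Q e₂ = e₂)
    (h₁ : ψ₁ e₁ = 1) (h₂ : ψ₂ e₂ = 1) {M : Set (X →L[𝕜] Y)} (hM : IsStableClass M)
    (H : HasBPBpRSE M) : UniformConvexSpace Y := by
  refine ⟨fun ε₀ hε₀ => ?_⟩
  -- The cap at 1 lets errors of order `e²` be absorbed into `e`.
  set e := min ε₀ 1 with he
  have he0 : 0 < e := lt_min hε₀ one_pos
  have he1 : e ≤ 1 := min_le_right _ _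
  have hQe₁ : Q e₁ = 0 := by
    have := hPQ.add_apply e₁
    rwa [hP, add_eq_left] at this
  have hPe₂ : P e₂ = 0 := by
    have := hPQ.add_apply e₂
    rwa [hQ, add_eq_right] at this
  have h12 : ψ₁ e₂ = 0 := norm_le_zero_iff.1 (by simpa [hPe₂] using hψ₁ e₂)
  have h21 : ψ₂ e₁ = 0 := norm_le_zero_iff.1 (by simpa [hQe₁] using hψ₂ e₁)
  set ε := e ^ 2 / 500 with hε
  have hεpos : 0 < ε := by positivity
  have he4 : e ≤ ε₀ := min_le_left _ _
  clear_value e ε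
  obtain ⟨η, hη, hηε, H⟩ := H ε hεpos
  refine ⟨2 * η, by positivity, fun y₁ hy₁ y₂ hy₂ hd => ?_⟩
  by_contra! hlt
  set T : X →L[𝕜] Y := ψ₁.smulRight y₁ + ψ₂.smulRight y₂ with hT
  have hTM : T ∈ M := by
    have h := hM.smul_comp_add_mem _ (hM.smul_comp_add_mem 0 hM.zero_mem 0 0 ψ₁ y₁) 1
      (ContinuousLinearMap.id 𝕜 X) ψ₂ y₂
    simpa [hT] using h
  have hTf : ∀ f, T f = ψ₁ f • y₁ + ψ₂ f • y₂ := fun f => by simp [hT]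
  have hT1 : ‖T‖ = 1 := by
    apply le_antisymm
    · refine T.opNorm_le_bound zero_le_one fun f => ?_
      rw [hTf, one_mul]
      refine (norm_add_le _ _).trans ?_
      rw [norm_smul, norm_smul, hy₁, hy₂, ← hPQ.norm_add_norm f]
      linarith [hψ₁ f, hψ₂ f]
    · have := T.le_opNorm e₁
      rwa [hTf, h₁, h21, one_smul, zero_smul, add_zero, hy₁, he₁, mul_one] at this
  set x : X := (2⁻¹ : 𝕜) • (e₁ + e₂) with hx
  have hPx : P x = (2⁻¹ : 𝕜) • e₁ := by simp [hx, hP, hPe₂]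
  have hQx : Q x = (2⁻¹ : 𝕜) • e₂ := by simp [hx, hQ, hQe₁]
  have hx1 : ‖x‖ = 1 := by
    rw [← hPQ.norm_add_norm x, hPx, hQx, norm_smul, norm_smul, he₁, he₂]; norm_num
  have hTx : T x = (2⁻¹ : 𝕜) • (y₁ + y₂) := by simp [hTf, hx, h₁, h₂, h12, h21, smul_add]
  obtain ⟨S, -, hS, x₀, hx₀, hS1, hSx₀, hST, hxx⟩ := H T hTM hT1 x hx1 (by
    rw [hTx, norm_smul, norm_inv, RCLike.norm_two]; linarith)
  obtain ⟨w, hw, hS⟩ := hS.exists_forall_eq_smul hS1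
  have hle : ∀ f, ‖S f‖ ≤ ‖f‖ := fun f => by simpa [hS1] using S.le_opNorm f
  -- Norm attainment at `x₀` forces equality in `‖S (P x₀)‖ + ‖S (Q x₀)‖ ≤ ‖P x₀‖ + ‖Q x₀‖`, hence
  -- in each term.
  have hsum : 1 ≤ ‖S (P x₀)‖ + ‖S (Q x₀)‖ := by
    rw [← hSx₀]
    conv_lhs => rw [← hPQ.add_apply x₀, map_add]
    exact norm_add_le _ _
  have hdec := hPQ.norm_add_norm x₀
  have hattP : ‖S (P x₀)‖ = ‖P x₀‖ := le_antisymm (hle _) (by linarith [hle (Q x₀)])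
  have hattQ : ‖S (Q x₀)‖ = ‖Q x₀‖ := le_antisymm (hle _) (by linarith [hle (P x₀)])
  have hw1 : ‖S w‖ ≤ 1 := by simpa [hw] using hle w
  have hPle : ∀ f, ‖P f‖ ≤ ‖f‖ := fun f => by
    linarith [hPQ.norm_add_norm f, norm_nonneg (Q f)]
  have hQle : ∀ f, ‖Q f‖ ≤ ‖f‖ := fun f => by
    linarith [hPQ.norm_add_norm f, norm_nonneg (P f)]
  obtain ⟨c, hc, hSc⟩ := hS _ hattP
  obtain ⟨d, hd', hSd⟩ := hS _ hattQ
  have hcy := norm_apply_sub_smul_le hT1.le hST.le he₁ ((hPle x₀).trans hx₀.le) hw1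
    (by rw [← hPx, ← map_sub]; exact (hPle _).trans hxx.le) hc hSc
  have hdy := norm_apply_sub_smul_le hT1.le hST.le he₂ ((hQle x₀).trans hx₀.le) hw1
    (by rw [← hQx, ← map_sub]; exact (hQle _).trans hxx.le) hd' hSd
  rw [hTf, h₁, h21, one_smul, zero_smul, add_zero] at hcy
  rw [hTf, h₂, h12, one_smul, zero_smul, zero_add] at hdy
  have hfin := norm_sub_lt_of_norm_sub_smul_le hw1 hc hd' he0 he1 (hε ▸ hcy) (hε ▸ hdy)
    (by rw [← hε]; linarith)
  linarith

end LDecomposition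

/-! ### Stability of the five operator classes -/

section StableClasses

variable {𝕜 : Type*} [RCLike 𝕜]
  {X : Type*} [NormedAddCommGroup X] [NormedSpace 𝕜 X]
  {Y : Type*} [NormedAddCommGroup Y] [NormedSpace 𝕜 Y]

lemma isStableClass_univ : IsStableClass (Set.univ : Set (X →L[𝕜] Y)) :=
  ⟨Set.mem_univ _, fun _ _ _ _ _ _ => Set.mem_univ _⟩

lemma isStableClass_isFiniteRankOperator :
    IsStableClass {T : X →L[𝕜] Y | IsFiniteRankOperator T} := by
  refine ⟨?_, fun T hT a Q ψ y => ?_⟩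
  · change FiniteDimensional 𝕜 (LinearMap.range (0 : X →ₗ[𝕜] Y))
    rw [LinearMap.range_zero]
    infer_instance
  · have hT' : FiniteDimensional 𝕜 (LinearMap.range (T : X →ₗ[𝕜] Y)) := hT
    have hle : LinearMap.range ((a • T.comp Q + ψ.smulRight y : X →L[𝕜] Y) : X →ₗ[𝕜] Y) ≤
        LinearMap.range (T : X →ₗ[𝕜] Y) ⊔ Submodule.span 𝕜 {y} := by
      rintro _ ⟨f, rfl⟩
      refine Submodule.add_mem_sup ?_ ?_
      · exact Submodule.smul_mem _ a ⟨Q f, rfl⟩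
      · exact Submodule.smul_mem _ (ψ f) (Submodule.mem_span_singleton_self y)
    exact Submodule.finiteDimensional_of_le hle

lemma isStableClass_isCompactOperator :
    IsStableClass {T : X →L[𝕜] Y | IsCompactOperator T} := by
  refine ⟨isCompactOperator_zero, fun T hT a Q ψ y => ?_⟩
  have h1 : IsCompactOperator (T.comp Q) := IsCompactOperator.comp_clm hT Q
  have h2 : IsCompactOperator (ψ.smulRight y) :=
    (isCompactOperator_of_locallyCompactSpace_rng
      (ContinuousLinearMap.toSpanSingleton 𝕜 y)).comp_clm ψ
  exact (h1.smul a).add h2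

instance weakSpace_t2Space : T2Space (WeakSpace 𝕜 Y) := by
  refine (WeakBilin.isEmbedding (B := (topDualPairing 𝕜 Y).flip) fun a b hab => ?_).t2Space
  refine (SeparatingDual.eq_iff_forall_dual_eq (R := 𝕜)).2 fun g => ?_
  exact DFunLike.congr_fun hab g

lemma isStableClass_isWeaklyCompactOperator :
    IsStableClass {T : X →L[𝕜] Y | IsWeaklyCompactOperator T} := by
  refine ⟨?_, fun T hT a Q ψ y => ?_⟩
  · refine (isCompact_singleton (x := (0 : WeakSpace 𝕜 Y))).of_isClosed_subset isClosed_closure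
      (closure_minimal ?_ isClosed_singleton)
    rintro _ ⟨_, ⟨f, -, rfl⟩, rfl⟩
    simp
  · have hK : IsCompact (closure (toWeakSpace 𝕜 Y '' (T '' Metric.closedBall (0 : X) 1))) := hT
    set K := closure (toWeakSpace 𝕜 Y '' (T '' Metric.closedBall (0 : X) 1))
    -- `Q` maps the unit ball into the ball of radius `‖Q‖`, so the image under the perturbed
    -- operator lies in a sum of two compact sets: a scaled copy of `K` and a disc of multiples of
    -- `y`.
    have hc1 : IsCompact ((fun k : WeakSpace 𝕜 Y => (a * (‖Q‖ : 𝕜)) • k) '' K) :=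
      hK.image (continuous_const_smul _)
    have hc2 : IsCompact ((fun c : 𝕜 => c • toWeakSpace 𝕜 Y y) '' Metric.closedBall 0 ‖ψ‖) :=
      (isCompact_closedBall _ _).image (continuous_id.smul continuous_const)
    have hc := hc1.add hc2
    refine hc.of_isClosed_subset isClosed_closure (closure_minimal ?_ hc.isClosed)
    rintro _ ⟨_, ⟨f, hf, rfl⟩, rfl⟩
    rw [mem_closedBall_zero_iff] at hf
    have e : toWeakSpace 𝕜 Y ((a • T.comp Q + ψ.smulRight y) f) =
        a • toWeakSpace 𝕜 Y (T (Q f)) + ψ f • toWeakSpace 𝕜 Y y := by simp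
    rw [e]
    refine Set.add_mem_add ?_ ⟨ψ f, ?_, rfl⟩
    · rcases eq_or_ne ‖Q‖ 0 with hQ | hQ
      · have hQf : Q f = 0 := by
          rw [norm_eq_zero.1 hQ]; rfl
        refine ⟨0, subset_closure ⟨0, ⟨0, by simp, by simp⟩, by simp⟩, ?_⟩
        simp [hQf]
      · have hQk : (‖Q‖ : 𝕜) ≠ 0 := by exact_mod_cast hQ
        refine ⟨toWeakSpace 𝕜 Y (T ((‖Q‖ : 𝕜)⁻¹ • Q f)), subset_closure
          ⟨_, ⟨_, ?_, rfl⟩, rfl⟩, ?_⟩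
        · rw [mem_closedBall_zero_iff, norm_smul, norm_inv, RCLike.norm_ofReal, abs_norm]
          rw [inv_mul_le_iff₀ (by positivity), mul_one]
          exact (Q.le_opNorm f).trans (mul_le_of_le_one_right (norm_nonneg _) hf)
        · simp only [map_smul]
          rw [smul_smul, mul_assoc, mul_inv_cancel₀ hQk, mul_one]
    · rw [mem_closedBall_zero_iff]
      exact (ψ.le_opNorm f).trans (mul_le_of_le_one_right (norm_nonneg _) hf)

/-- The image of a vector measure under a bounded operator. -/
noncomputable def mapVectorMeasure {R E F Ω : Type*} [NormedField R] [NormedAddCommGroup E]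
    [NormedSpace R E] [NormedAddCommGroup F] [NormedSpace R F] [MeasurableSpace Ω] (L : E →L[R] F)
    (G : VectorMeasure Ω E) : VectorMeasure Ω F :=
  G.mapRange (L : E →ₗ[R] F).toAddMonoidHom L.continuous

lemma mapVectorMeasure_apply {R E F Ω : Type*} [NormedField R] [NormedAddCommGroup E]
    [NormedSpace R E] [NormedAddCommGroup F] [NormedSpace R F] [MeasurableSpace Ω] (L : E →L[R] F)
    (G : VectorMeasure Ω E) (s : Set Ω) : mapVectorMeasure L G s = L (G s) := rfl

/-- Scalar Radon–Nikodým theorem, from the signed case applied to real and imaginary parts. It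
provides the density of the rank-one term `ψ ⊗ y`. -/
lemma exists_integrable_density_of_absolutelyContinuous {Ω : Type*} [MeasurableSpace Ω]
    (ν : Measure Ω) [IsFiniteMeasure ν] (G : VectorMeasure Ω 𝕜)
    (hG : ∀ s, MeasurableSet s → ν s = 0 → G s = 0) :
    ∃ g : Ω → 𝕜, Integrable g ν ∧ ∀ s, MeasurableSet s → G s = ∫ ω in s, g ω ∂ν := by
  have key : ∀ L : 𝕜 →L[ℝ] ℝ, ∃ g : Ω → ℝ, Integrable g ν ∧
      ∀ s, MeasurableSet s → L (G s) = ∫ ω in s, g ω ∂ν := by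
    intro L
    set σ : SignedMeasure Ω := mapVectorMeasure L G with hσ
    have hac : VectorMeasure.AbsolutelyContinuous σ ν.toENNRealVectorMeasure := by
      refine VectorMeasure.AbsolutelyContinuous.mk fun s hs h => ?_
      rw [Measure.toENNRealVectorMeasure_apply_measurable hs] at h
      rw [hσ, mapVectorMeasure_apply, hG s hs h, map_zero]
    refine ⟨σ.rnDeriv ν, SignedMeasure.integrable_rnDeriv _ _, fun s hs => ?_⟩
    rw [← withDensityᵥ_apply (SignedMeasure.integrable_rnDeriv _ _) hs,
      SignedMeasure.withDensityᵥ_rnDeriv_eq σ ν hac]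
    rfl
  obtain ⟨g₁, hg₁, h₁⟩ := key RCLike.reCLM
  obtain ⟨g₂, hg₂, h₂⟩ := key RCLike.imCLM
  refine ⟨fun ω => (g₁ ω : 𝕜) + (g₂ ω : 𝕜) * RCLike.I,
    hg₁.ofReal.add (hg₂.ofReal.mul_const _), fun s hs => ?_⟩
  refine Eq.symm ((integral_add (f := fun ω => (g₁ ω : 𝕜))
    (g := fun ω => (g₂ ω : 𝕜) * RCLike.I) hg₁.ofReal.integrableOn
    (hg₂.ofReal.mul_const _).integrableOn).trans ?_)
  rw [integral_mul_const, integral_ofReal, integral_ofReal, ← h₁ s hs, ← h₂ s hs]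
  exact RCLike.re_add_im (G s)

lemma variation_mapVectorMeasure_univ_lt_top {Ω : Type*} [MeasurableSpace Ω] {G : VectorMeasure Ω X}
    (hG : G.variation Set.univ < ⊤) (Q : X →L[𝕜] X) :
    (mapVectorMeasure Q G).variation Set.univ < ⊤ := by
  refine (VectorMeasure.variation_apply_le_of_forall_enorm_le (m := ‖Q‖₊ • G.variation)
    MeasurableSet.univ fun E _ _ => ?_).trans_lt ?_
  · rw [mapVectorMeasure_apply]
    refine (Q.le_opENorm (G E)).trans ?_
    rw [Measure.smul_apply, ENNReal.smul_def, smul_eq_mul, enorm_eq_nnnorm Q]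
    gcongr
    exact VectorMeasure.enorm_measure_le_variation _ _
  · rw [Measure.smul_apply, ENNReal.smul_def, smul_eq_mul]
    exact ENNReal.mul_lt_top ENNReal.coe_lt_top hG

lemma isStableClass_isRadonNikodymOperator {𝕜 : Type z} [RCLike 𝕜]
    {X : Type v} [NormedAddCommGroup X] [NormedSpace 𝕜 X]
    {Y : Type u} [NormedAddCommGroup Y] [NormedSpace 𝕜 Y] [CompleteSpace Y] :
    IsStableClass {T : X →L[𝕜] Y | IsRadonNikodymOperator.{u, v, w, z} T} := by
  let _ : NormedSpace ℝ Y := NormedSpace.restrictScalars ℝ 𝕜 Y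
  have _ : IsScalarTower ℝ 𝕜 Y := IsScalarTower.of_algebraMap_smul fun _ _ => rfl
  refine ⟨fun Ω _ ν _ G _ _ => ⟨0, integrable_zero _ _ _, fun s _ => by simp⟩,
    fun T hT a Q ψ y Ω _ ν _ G hG hac => ?_⟩
  obtain ⟨f, hf, hTf⟩ := hT Ω ν (mapVectorMeasure Q G)
    (variation_mapVectorMeasure_univ_lt_top hG Q) (fun s hs h => by
      rw [mapVectorMeasure_apply, hac s hs h, map_zero])
  obtain ⟨g, hg, hψg⟩ := exists_integrable_density_of_absolutelyContinuous ν
    (mapVectorMeasure ψ G) (fun s hs h => by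
      rw [mapVectorMeasure_apply, hac s hs h, map_zero])
  refine ⟨fun ω => a • f ω + g ω • y, (hf.smul a).add (hg.smul_const y), fun s hs => ?_⟩
  have h1 : T (Q (G s)) = ∫ ω in s, f ω ∂ν := hTf s hs
  have h2 : ψ (G s) = ∫ ω in s, g ω ∂ν := hψg s hs
  have e : (a • T.comp Q + ψ.smulRight y) (G s) = a • T (Q (G s)) + ψ (G s) • y := rfl
  rw [e, h1, h2]
  refine Eq.symm ((integral_add (f := fun ω => a • f ω) (g := fun ω => g ω • y)
    (hf.smul a).integrableOn (hg.smul_const y).integrableOn).trans ?_)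
  rw [integral_smul, integral_smul_const]

end StableClasses

/-! ### Multiplication and restriction operators on `L¹` -/

section RestrictionOperators

open scoped ENNReal NNReal

variable {𝕜 : Type*} [RCLike 𝕜] {Ω : Type*} [MeasurableSpace Ω] {μ : Measure Ω}

/-- Multiplication by a bounded function on `L¹`. -/
noncomputable def L1mul (b : Lp 𝕜 ∞ μ) : Lp 𝕜 1 μ →L[𝕜] Lp 𝕜 1 μ :=
  (ContinuousLinearMap.mul 𝕜 𝕜).holderL μ ∞ 1 1 b

lemma coeFn_L1mul (b : Lp 𝕜 ∞ μ) (f : Lp 𝕜 1 μ) : L1mul b f =ᵐ[μ] fun ω => b ω * f ω :=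
  (ContinuousLinearMap.mul 𝕜 𝕜).coeFn_holder b f

lemma exists_L1_mul {b : Ω → 𝕜} (hb : Measurable b) (hb1 : ∀ ω, ‖b ω‖ ≤ 1) :
    ∃ M : Lp 𝕜 1 μ →L[𝕜] Lp 𝕜 1 μ, ∀ f, M f =ᵐ[μ] fun ω => b ω * f ω := by
  have hm : MemLp b ∞ μ :=
    memLp_top_of_bound hb.aestronglyMeasurable 1 (Eventually.of_forall hb1)
  refine ⟨L1mul (hm.toLp b), fun f => ?_⟩
  filter_upwards [coeFn_L1mul (hm.toLp b) f, hm.coeFn_toLp] with ω h1 h2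
  rw [h1, h2]

open Classical in
/-- Restriction of `L¹` functions to a measurable set. -/
noncomputable def L1restrict (μ : Measure Ω) (A : Set Ω) : Lp 𝕜 1 μ →L[𝕜] Lp 𝕜 1 μ :=
  if hA : MeasurableSet A then
    L1mul (((memLp_top_const (1 : 𝕜)).indicator hA).toLp _)
  else 0

lemma L1restrict_of_not_measurableSet {A : Set Ω} (hA : ¬MeasurableSet A) :
    (L1restrict μ A : Lp 𝕜 1 μ →L[𝕜] Lp 𝕜 1 μ) = 0 := dif_neg hA

lemma coeFn_L1restrict {A : Set Ω} (hA : MeasurableSet A) (f : Lp 𝕜 1 μ) :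
    L1restrict μ A f =ᵐ[μ] A.indicator f := by
  rw [L1restrict, dif_pos hA]
  refine (coeFn_L1mul _ f).trans ?_
  filter_upwards [((memLp_top_const (μ := μ) (1 : 𝕜)).indicator hA).coeFn_toLp] with ω h
  rw [h]
  by_cases hω : ω ∈ A <;> simp [hω]

lemma norm_L1restrict {A : Set Ω} (hA : MeasurableSet A) (f : Lp 𝕜 1 μ) :
    ‖L1restrict μ A f‖ = ∫ ω in A, ‖f ω‖ ∂μ := by
  rw [L1.norm_eq_integral_norm, ← integral_indicator hA]
  refine integral_congr_ae ?_
  filter_upwards [coeFn_L1restrict hA f] with ω h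
  rw [h, norm_indicator_eq_indicator_norm]

lemma L1restrict_L1restrict {A B : Set Ω} (hA : MeasurableSet A) (hB : MeasurableSet B)
    (f : Lp 𝕜 1 μ) : L1restrict μ A (L1restrict μ B f) = L1restrict μ (A ∩ B) f := by
  apply Lp.ext
  filter_upwards [coeFn_L1restrict hA (L1restrict μ B f), coeFn_L1restrict hB f,
    coeFn_L1restrict (hA.inter hB) f] with ω h1 h2 h3
  rw [h1, h3, ← Set.indicator_indicator]
  by_cases hω : ω ∈ A <;> simp [hω, h2]

lemma L1restrict_union {A B : Set Ω} (hA : MeasurableSet A) (hB : MeasurableSet B)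
    (hAB : Disjoint A B) (f : Lp 𝕜 1 μ) :
    L1restrict μ (A ∪ B) f = L1restrict μ A f + L1restrict μ B f := by
  apply Lp.ext
  filter_upwards [coeFn_L1restrict hA f, coeFn_L1restrict hB f,
    coeFn_L1restrict (hA.union hB) f,
    Lp.coeFn_add (L1restrict μ A f) (L1restrict μ B f)] with ω h1 h2 h3 h4
  rw [h3, h4, Set.indicator_union_of_disjoint hAB, Pi.add_apply, h1, h2]

lemma L1restrict_univ (f : Lp 𝕜 1 μ) : L1restrict μ Set.univ f = f := by
  apply Lp.ext
  filter_upwards [coeFn_L1restrict MeasurableSet.univ f] with ω h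
  rw [h, Set.indicator_univ]

lemma isLDecomposition_L1restrict {A : Set Ω} (hA : MeasurableSet A) :
    IsLDecomposition (L1restrict μ A : Lp 𝕜 1 μ →L[𝕜] Lp 𝕜 1 μ) (L1restrict μ Aᶜ) := by
  refine ⟨fun f => ?_, fun f => ?_⟩
  · rw [← L1restrict_union hA hA.compl disjoint_compl_right, Set.union_compl_self,
      L1restrict_univ]
  · rw [norm_L1restrict hA, norm_L1restrict hA.compl,
      integral_add_compl hA (L1.integrable_coeFn f).norm, L1.norm_eq_integral_norm]

lemma exists_functional_mul {A : Set Ω} (hA : MeasurableSet A) {b : Ω → 𝕜} (hb : Measurable b)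
    (hb1 : ∀ ω, ‖b ω‖ ≤ 1) :
    ∃ ψ : Lp 𝕜 1 μ →L[𝕜] 𝕜, (∀ f, ψ f = ∫ ω in A, b ω * f ω ∂μ) ∧
      ∀ f, ‖ψ f‖ ≤ ‖L1restrict μ A f‖ := by
  obtain ⟨M, hM⟩ := exists_L1_mul (μ := μ) hb hb1
  have h : ∀ f, (L1.integralCLM' (E := 𝕜) 𝕜).comp (M.comp (L1restrict μ A)) f =
      ∫ ω in A, b ω * f ω ∂μ := by
    intro f
    change L1.integralCLM' 𝕜 (M (L1restrict μ A f)) = _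
    rw [← L1.integral_eq', L1.integral_eq_integral, ← integral_indicator hA]
    refine integral_congr_ae ?_
    filter_upwards [hM (L1restrict μ A f), coeFn_L1restrict hA f] with ω h1 h2
    rw [h1, h2]
    by_cases hω : ω ∈ A <;> simp [hω]
  refine ⟨_, h, fun f => ?_⟩
  rw [h, norm_L1restrict hA]
  refine norm_integral_le_of_norm_le (L1.integrable_coeFn f).norm.integrableOn
    (Eventually.of_forall fun ω => ?_)
  rw [norm_mul]
  exact mul_le_of_le_one_left (norm_nonneg _) (hb1 ω)

end RestrictionOperators

/-! ### Two disjoint non-null sets and the necessity of uniform convexity -/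

section DisjointSets

open scoped ENNReal NNReal

variable {𝕜 : Type*} [RCLike 𝕜] {Ω : Type*} [MeasurableSpace Ω] {μ : Measure Ω}

/-- If every measurable set were null or conull, every `L¹` function would be a.e. constant and the
dimension at most one. -/
lemma exists_measurableSet_ne_zero_compl_ne_zero (hdim : 2 ≤ Module.rank 𝕜 (Lp 𝕜 1 μ)) :
    ∃ A, MeasurableSet A ∧ μ A ≠ 0 ∧ μ Aᶜ ≠ 0 := by
  by_contra! H
  have hconst : ∀ f : Lp 𝕜 1 μ, ∃ a : 𝕜, f =ᵐ[μ] Function.const Ω a := by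
    intro f
    refine Filter.exists_eventuallyEq_const_of_forall_separating MeasurableSet fun U hU => ?_
    have hm : MeasurableSet (f ⁻¹' U) := (Lp.stronglyMeasurable f).measurable hU
    by_cases h : μ (f ⁻¹' U) = 0
    · exact Or.inr (measure_eq_zero_iff_ae_notMem.1 h)
    · exact Or.inl (mem_ae_iff.2 (H _ hm h))
  have hle : Module.rank 𝕜 (Lp 𝕜 1 μ) ≤ 1 := by
    refine rank_le_one_iff.2 ?_
    by_cases h0 : ∃ f : Lp 𝕜 1 μ, f ≠ 0
    · obtain ⟨f, hf⟩ := h0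
      obtain ⟨a, ha⟩ := hconst f
      have ha0 : a ≠ 0 := by
        rintro rfl
        exact hf ((Lp.eq_zero_iff_ae_eq_zero).2 ha)
      refine ⟨f, fun g => ?_⟩
      obtain ⟨b, hb⟩ := hconst g
      refine ⟨b / a, Lp.ext ?_⟩
      filter_upwards [Lp.coeFn_smul (b / a) f, ha, hb] with ω h1 h2 h3
      rw [h1, Pi.smul_apply, h2, h3]
      simp [ha0]
    · push Not at h0
      exact ⟨0, fun g => ⟨0, by rw [h0 g, smul_zero]⟩⟩
  have h21 : (2 : Cardinal) ≤ 1 := hdim.trans hle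
  exact absurd h21 (by norm_num)

lemma exists_normalized_indicator [SigmaFinite μ] {A : Set Ω} (hA : MeasurableSet A)
    (hμA : μ A ≠ 0) : ∃ e : Lp 𝕜 1 μ, ‖e‖ = 1 ∧ L1restrict μ A e = e ∧ ∫ ω in A, e ω ∂μ = 1 := by
  obtain ⟨B, hB, hBA, hB0, hBtop⟩ :=
    Measure.exists_subset_measure_lt_top hA (pos_iff_ne_zero.2 hμA)
  have hr : μ.real B ≠ 0 := by
    rw [measureReal_def, ENNReal.toReal_ne_zero]
    exact ⟨hB0.ne', hBtop.ne⟩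
  have hr0 : (0 : ℝ) < μ.real B := lt_of_le_of_ne measureReal_nonneg hr.symm
  have hrk : (μ.real B : 𝕜) ≠ 0 := by exact_mod_cast hr
  set e : Lp 𝕜 1 μ := indicatorConstLp 1 hB hBtop.ne ((μ.real B : 𝕜)⁻¹) with he
  have hae : e =ᵐ[μ] B.indicator fun _ => (μ.real B : 𝕜)⁻¹ := indicatorConstLp_coeFn
  have hres : L1restrict μ A e = e := by
    apply Lp.ext
    filter_upwards [coeFn_L1restrict hA e, hae] with ω h1 h2
    rw [h1]
    by_cases hω : ω ∈ A
    · simp [hω]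
    · rw [Set.indicator_of_notMem hω, h2, Set.indicator_of_notMem fun h => hω (hBA h)]
  refine ⟨e, ?_, hres, ?_⟩
  · rw [he, norm_indicatorConstLp one_ne_zero ENNReal.one_ne_top, norm_inv, RCLike.norm_ofReal,
      abs_of_pos hr0]
    simp [hr]
  · have : ∫ ω in A, e ω ∂μ = ∫ ω in A, B.indicator (fun _ => (μ.real B : 𝕜)⁻¹) ω ∂μ :=
      integral_congr_ae (ae_restrict_of_ae hae)
    rw [this, setIntegral_indicator hB, Set.inter_eq_self_of_subset_right hBA, setIntegral_const,
      RCLike.real_smul_eq_coe_mul, mul_inv_cancel₀ hrk]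

theorem uniformConvexSpace_of_hasBPBpRSE_L1 [SigmaFinite μ]
    {Y : Type*} [NormedAddCommGroup Y] [NormedSpace 𝕜 Y]
    (hdim : 2 ≤ Module.rank 𝕜 (Lp 𝕜 1 μ)) {M : Set (Lp 𝕜 1 μ →L[𝕜] Y)} (hM : IsStableClass M)
    (H : HasBPBpRSE M) : UniformConvexSpace Y := by
  obtain ⟨A, hA, h1, h2⟩ := exists_measurableSet_ne_zero_compl_ne_zero hdim
  obtain ⟨e₁, he₁, hP, hi₁⟩ := exists_normalized_indicator (𝕜 := 𝕜) hA h1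
  obtain ⟨e₂, he₂, hQ, hi₂⟩ := exists_normalized_indicator (𝕜 := 𝕜) hA.compl h2
  obtain ⟨ψ₁, hψ₁, hψ₁'⟩ := exists_functional_mul (𝕜 := 𝕜) (μ := μ) hA
    (measurable_const (a := (1 : 𝕜))) (by simp)
  obtain ⟨ψ₂, hψ₂, hψ₂'⟩ := exists_functional_mul (𝕜 := 𝕜) (μ := μ) hA.compl
    (measurable_const (a := (1 : 𝕜))) (by simp)
  exact uniformConvexSpace_of_hasBPBpRSE (isLDecomposition_L1restrict hA) hψ₁' hψ₂' he₁ he₂ hP hQ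
    (by simpa [hψ₁] using hi₁) (by simpa [hψ₂] using hi₂) hM H

end DisjointSets

/-! ### The measure `|x| μ` and sets on which a functional nearly norms `x` -/

section DensityMeasure

open scoped ENNReal NNReal

variable {𝕜 : Type*} [RCLike 𝕜] {Ω : Type*} [MeasurableSpace Ω] {μ : Measure Ω}
  {Y : Type*} [NormedAddCommGroup Y] [NormedSpace 𝕜 Y]

/-- The measure with density `|x|`. -/
noncomputable def absMeasure (x : Lp 𝕜 1 μ) : Measure Ω :=
  μ.withDensity fun ω => (‖x ω‖₊ : ℝ≥0∞)

lemma measurable_nnnorm_coeFn (x : Lp 𝕜 1 μ) : Measurable fun ω => ‖x ω‖₊ :=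
  (Lp.stronglyMeasurable x).measurable.nnnorm

lemma absMeasure_apply (x : Lp 𝕜 1 μ) {E : Set Ω} (hE : MeasurableSet E) :
    absMeasure x E = ‖L1restrict μ E x‖ₑ := by
  rw [absMeasure, withDensity_apply _ hE, ← ofReal_norm, norm_L1restrict hE,
    ofReal_integral_norm_eq_lintegral_enorm (L1.integrable_coeFn x).integrableOn]
  rfl

instance isFiniteMeasure_absMeasure (x : Lp 𝕜 1 μ) : IsFiniteMeasure (absMeasure x) :=
  ⟨by rw [absMeasure_apply x MeasurableSet.univ]; exact enorm_lt_top⟩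

lemma absMeasure_real (x : Lp 𝕜 1 μ) {E : Set Ω} (hE : MeasurableSet E) :
    (absMeasure x).real E = ‖L1restrict μ E x‖ := by
  rw [measureReal_def, absMeasure_apply x hE, toReal_enorm]

/-- `A` is the positive set in a Hahn decomposition of `E ↦ Re φ(x 1_E) - r ‖x 1_E‖`. -/
lemma exists_set_re_apply_ge (x : Lp 𝕜 1 μ) {φ : Lp 𝕜 1 μ →L[𝕜] 𝕜} (hφ : ‖φ‖ ≤ 1) (r : ℝ) :
    ∃ A, MeasurableSet A ∧
      (∀ E, MeasurableSet E → E ⊆ A →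
        r * ‖L1restrict μ E x‖ ≤ RCLike.re (φ (L1restrict μ E x))) ∧
      RCLike.re (φ (L1restrict μ Aᶜ x)) ≤ r * ‖L1restrict μ Aᶜ x‖ := by
  -- Domination by the finite measure `|x| μ` upgrades finite additivity to countable additivity.
  have hbd : ∀ E, ‖RCLike.re (φ (L1restrict μ E x))‖ₑ ≤ absMeasure x E := by
    intro E
    by_cases hE : MeasurableSet E
    · rw [absMeasure_apply x hE, enorm_le_iff_norm_le, Real.norm_eq_abs]
      refine (RCLike.abs_re_le_norm _).trans ?_
      have := φ.le_of_opNorm_le hφ (L1restrict μ E x)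
      linarith
    -- Restriction to a non-measurable set is `0` by definition, matching the convention for vector
    -- measures.
    · simp [L1restrict_of_not_measurableSet hE]
  set σ : SignedMeasure Ω := VectorMeasure.of_additive_of_le_measure
    (fun E => RCLike.re (φ (L1restrict μ E x))) hbd
    (fun s t hs ht hst => by simp [L1restrict_union hs ht hst])
    (fun s hs => by simp [L1restrict_of_not_measurableSet hs]) with hσ
  have hσa : ∀ E, σ E = RCLike.re (φ (L1restrict μ E x)) := fun E => rfl
  have hτ : ∀ E, MeasurableSet E → (σ - r • (absMeasure x).toSignedMeasure) E =
      RCLike.re (φ (L1restrict μ E x)) - r * ‖L1restrict μ E x‖ := by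
    intro E hE
    rw [sub_apply, smul_apply, Measure.toSignedMeasure_apply_measurable hE,
      absMeasure_real x hE, hσa, smul_eq_mul]
  obtain ⟨A, hA, h1, h2⟩ :=
    SignedMeasure.exists_compl_positive_negative (σ - r • (absMeasure x).toSignedMeasure)
  refine ⟨A, hA, fun E hE hEA => ?_, ?_⟩
  · have := VectorMeasure.subset_le_of_restrict_le_restrict _ _ hA h1 hEA
    rw [hτ E hE] at this
    exact sub_nonneg.1 this
  · have := VectorMeasure.subset_le_of_restrict_le_restrict _ _ hA.compl h2 subset_rfl
    rw [hτ _ hA.compl] at this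
    exact sub_nonpos.1 this

lemma exists_set_re_apply_ge_and_norm_gt {x : Lp 𝕜 1 μ} (hx : ‖x‖ = 1) {φ : Lp 𝕜 1 μ →L[𝕜] 𝕜}
    (hφ : ‖φ‖ ≤ 1) {ρ τ : ℝ} (hρ : 0 < ρ) (hφx : 1 - ρ * τ < RCLike.re (φ x)) :
    ∃ A, MeasurableSet A ∧ (∀ ω ∈ A, x ω ≠ 0) ∧
      (∀ E, MeasurableSet E → E ⊆ A →
        (1 - ρ) * ‖L1restrict μ E x‖ ≤ RCLike.re (φ (L1restrict μ E x))) ∧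
      1 - τ < ‖L1restrict μ A x‖ := by
  obtain ⟨A, hA, h1, h2⟩ := exists_set_re_apply_ge x hφ (1 - ρ)
  -- Discarding the zeros of `x` leaves its restriction unchanged and later permits division by `x`
  -- on `A`.
  have hN : MeasurableSet {ω | x ω ≠ 0} :=
    ((Lp.stronglyMeasurable x).measurable (measurableSet_singleton (0 : 𝕜))).compl
  have hres : L1restrict μ (A ∩ {ω | x ω ≠ 0}) x = L1restrict μ A x := by
    apply Lp.ext
    filter_upwards [coeFn_L1restrict hA x, coeFn_L1restrict (hA.inter hN) x] with ω h3 h4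
    rw [h3, h4, ← Set.indicator_indicator]
    by_cases hω : ω ∈ A
    · by_cases h0 : x ω = 0 <;> simp [hω, h0]
    · simp [hω]
  refine ⟨A ∩ {ω | x ω ≠ 0}, hA.inter hN, fun ω hω => hω.2,
    fun E hE hEA => h1 E hE (hEA.trans Set.inter_subset_left), ?_⟩
  rw [hres]
  have hdec := isLDecomposition_L1restrict (𝕜 := 𝕜) (μ := μ) hA
  have h3 : RCLike.re (φ x) = RCLike.re (φ (L1restrict μ A x)) +
      RCLike.re (φ (L1restrict μ Aᶜ x)) := by
    rw [← map_add, ← map_add, hdec.add_apply]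
  have h4 : RCLike.re (φ (L1restrict μ A x)) ≤ ‖L1restrict μ A x‖ :=
    (RCLike.re_le_norm _).trans (by simpa using φ.le_of_opNorm_le hφ (L1restrict μ A x))
  have h5 := hdec.norm_add_norm x
  rw [hx] at h5
  -- With `m = ‖x 1_A‖`, `1 - ρ τ < Re φ(x) ≤ m + (1 - ρ)(1 - m)`.
  have h6 : ρ * (1 - τ) < ρ * ‖L1restrict μ A x‖ := by nlinarith
  exact lt_of_mul_lt_mul_left h6 hρ.le

lemma norm_toLp_add_of_disjoint {f g : Ω → 𝕜} (hf : MemLp f 1 μ) (hg : MemLp g 1 μ)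
    (hfg : Disjoint (Function.support f) (Function.support g)) :
    ‖hf.toLp f + hg.toLp g‖ = ‖hf.toLp f‖ + ‖hg.toLp g‖ := by
  rw [L1.norm_eq_integral_norm, L1.norm_eq_integral_norm, L1.norm_eq_integral_norm,
    ← integral_add (L1.integrable_coeFn _).norm (L1.integrable_coeFn _).norm]
  refine integral_congr_ae ?_
  filter_upwards [Lp.coeFn_add (hf.toLp f) (hg.toLp g), hf.coeFn_toLp, hg.coeFn_toLp]
    with ω h1 h2 h3
  rw [h1, Pi.add_apply, h2, h3]
  by_cases h : f ω = 0
  · simp [h]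
  · have : g ω = 0 := by
      by_contra h'
      exact Set.disjoint_left.1 hfg h h'
    simp [this]

lemma exists_linearIsometry_absMeasure (x : Lp 𝕜 1 μ) :
    ∃ J : Lp 𝕜 1 (absMeasure x) →ₗᵢ[ℝ] Lp 𝕜 1 μ, ∀ g, J g =ᵐ[μ] fun ω => ‖x ω‖ • g ω := by
  refine ⟨withDensitySMulLI (E := 𝕜) μ (measurable_nnnorm_coeFn x), fun g => ?_⟩
  exact MemLp.coeFn_toLp (memL1_smul_of_L1_withDensity (measurable_nnnorm_coeFn x) g)

lemma ae_of_ae_absMeasure {x : Lp 𝕜 1 μ} {p : Ω → Prop} (h : ∀ᵐ ω ∂absMeasure x, p ω) :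
    ∀ᵐ ω ∂μ, x ω ≠ 0 → p ω := by
  filter_upwards [(ae_withDensity_iff (measurable_nnnorm_coeFn x).coe_nnreal_ennreal).1 h]
    with ω h h0
  exact h (by simpa using h0)

/-- An operator vanishing off a set `A` where `x` does not vanish is bounded by `ε` as soon as it is
so on the restrictions of `x` to measurable subsets of `A`. -/
lemma norm_apply_le_of_norm_apply_restrict_le {x : Lp 𝕜 1 μ} {A : Set Ω} (hA : MeasurableSet A)
    (hxA : ∀ ω ∈ A, x ω ≠ 0) {U : Lp 𝕜 1 μ →L[𝕜] Y} (hUA : ∀ f, U (L1restrict μ A f) = U f)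
    {ε : ℝ} (hε : 0 ≤ ε)
    (hU : ∀ E, MeasurableSet E → E ⊆ A → ‖U (L1restrict μ E x)‖ ≤ ε * ‖L1restrict μ E x‖)
    (f : Lp 𝕜 1 μ) : ‖U f‖ ≤ ε * ‖f‖ := by
  -- `Θ` multiplies by the phase `x / |x|` and `J` by `|x|`. Their composite `L¹(|x| μ) → L¹(μ)`
  -- sends the indicator of `E` to `x 1_E`, where the hypothesis applies.
  have hxm : Measurable x := (Lp.stronglyMeasurable x).measurable
  obtain ⟨Θ, hΘ⟩ := exists_L1_mul (μ := μ) (b := fun ω => x ω * ((‖x ω‖⁻¹ : ℝ) : 𝕜))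
    (hxm.mul (RCLike.measurable_ofReal.comp hxm.norm.inv)) (fun ω => by
      rw [norm_mul, RCLike.norm_ofReal, abs_of_nonneg (inv_nonneg.2 (norm_nonneg _))]
      exact mul_inv_le_one)
  have hm := measurable_nnnorm_coeFn x
  obtain ⟨J, hJae⟩ := exists_linearIsometry_absMeasure x
  -- the composite `Θ ∘ J` is multiplication by `x`
  have hΘJ : ∀ g, Θ (J g) =ᵐ[μ] fun ω => x ω * g ω := by
    intro g
    filter_upwards [hΘ (J g), hJae g] with ω h1 h2
    rw [h1, h2, RCLike.real_smul_eq_coe_mul]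
    by_cases h0 : x ω = 0
    · simp [h0]
    · have : (‖x ω‖ : 𝕜) ≠ 0 := by exact_mod_cast norm_ne_zero_iff.2 h0
      push_cast
      field_simp
  have key : ∀ g, ‖U (Θ (J g))‖ ≤ ε * ‖g‖ := by
    intro g
    refine Lp.induction ENNReal.one_ne_top
      (motive := fun g => ‖U (Θ (J g))‖ ≤ ε * ‖g‖) ?_ ?_ ?_ g
    · intro c E hE hμE
      rw [Lp.simpleFunc.coe_indicatorConst]
      have hae : Θ (J (indicatorConstLp 1 hE hμE.ne c)) = c • L1restrict μ E x := by
        apply Lp.ext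
        have hind := ae_of_ae_absMeasure
          (indicatorConstLp_coeFn (p := 1) (hs := hE) (hμs := hμE.ne) (c := c))
        filter_upwards [hΘJ (indicatorConstLp 1 hE hμE.ne c), hind,
          Lp.coeFn_smul c (L1restrict μ E x), coeFn_L1restrict hE x] with ω h1 h2 h3 h4
        rw [h1, h3, Pi.smul_apply, h4]
        by_cases h0 : x ω = 0
        · by_cases hω : ω ∈ E <;> simp [h0, hω]
        · rw [h2 h0]
          by_cases hω : ω ∈ E <;> simp [hω, mul_comm]
      have hnorm : ‖indicatorConstLp 1 hE hμE.ne c‖ = ‖c‖ * ‖L1restrict μ E x‖ := by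
        rw [norm_indicatorConstLp one_ne_zero ENNReal.one_ne_top, absMeasure_real x hE]
        simp
      rw [hae, hnorm, map_smul, norm_smul, ← hUA, L1restrict_L1restrict hA hE]
      have h1 := hU _ (hA.inter hE) Set.inter_subset_left
      have h2 : ‖L1restrict μ (A ∩ E) x‖ ≤ ‖L1restrict μ E x‖ := by
        rw [← L1restrict_L1restrict hA hE]
        have := (isLDecomposition_L1restrict (𝕜 := 𝕜) (μ := μ) hA).norm_add_norm
          (L1restrict μ E x)
        linarith [norm_nonneg (L1restrict μ Aᶜ (L1restrict μ E x))]
      have h3 := h1.trans (mul_le_mul_of_nonneg_left h2 hε)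
      calc ‖c‖ * ‖U (L1restrict μ (A ∩ E) x)‖ ≤ ‖c‖ * (ε * ‖L1restrict μ E x‖) := by gcongr
        _ = ε * (‖c‖ * ‖L1restrict μ E x‖) := by ring
    · intro f g hf hg hfg h1 h2
      rw [norm_toLp_add_of_disjoint hf hg hfg, map_add, map_add, map_add, mul_add]
      exact (norm_add_le _ _).trans (add_le_add h1 h2)
    · exact isClosed_le
        (U.continuous.comp (Θ.continuous.comp J.continuous)).norm
        (continuous_const.mul continuous_norm)
  -- On `A` every `f` is `x · (f / x)`, so `U f` is the value of `U ∘ Θ ∘ J` at `f / x`, whose norm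
  -- in `L¹(|x| μ)` is at most `‖f‖`.
  have hg : MemLp (fun ω => (x ω)⁻¹ * f ω) 1 (absMeasure x) := by
    rw [memLp_one_iff_integrable, absMeasure, integrable_withDensity_iff_integrable_smul hm]
    refine (L1.integrable_coeFn f).mono ?_ (Eventually.of_forall fun ω => ?_)
    · exact (hm.smul (hxm.inv.mul (Lp.stronglyMeasurable f).measurable)).aestronglyMeasurable
    · rw [NNReal.smul_def, norm_smul, norm_mul, norm_inv, coe_nnnorm, norm_norm, ← mul_assoc]
      exact mul_le_of_le_one_left (norm_nonneg _) mul_inv_le_one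
  set g := hg.toLp _
  have hgae : ∀ᵐ ω ∂μ, x ω ≠ 0 → g ω = (x ω)⁻¹ * f ω :=
    ae_of_ae_absMeasure hg.coeFn_toLp
  have hUf : U f = U (Θ (J g)) := by
    rw [← hUA f, ← hUA (Θ (J g))]
    congr 1
    apply Lp.ext
    filter_upwards [coeFn_L1restrict hA f, coeFn_L1restrict hA (Θ (J g)), hΘJ g, hgae]
      with ω h1 h2 h3 h4
    rw [h1, h2]
    by_cases hω : ω ∈ A
    · rw [Set.indicator_of_mem hω, Set.indicator_of_mem hω, h3, h4 (hxA ω hω),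
        mul_inv_cancel_left₀ (hxA ω hω)]
    · simp [hω]
  have hgf : ‖g‖ ≤ ‖f‖ := by
    rw [← J.norm_map g, L1.norm_eq_integral_norm, L1.norm_eq_integral_norm]
    refine integral_mono_ae (L1.integrable_coeFn _).norm (L1.integrable_coeFn _).norm ?_
    filter_upwards [hJae g, hgae] with ω h1 h2
    rw [h1, norm_smul, norm_norm]
    by_cases h0 : x ω = 0
    · simp [h0]
    · rw [h2 h0, norm_mul, norm_inv, mul_inv_cancel_left₀ (norm_ne_zero_iff.2 h0)]
  rw [hUf]
  exact (key g).trans (mul_le_mul_of_nonneg_left hgf hε)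

end DensityMeasure

/-! ### Rank-one approximation and the sufficiency of uniform convexity -/

section Approximation

open scoped ENNReal NNReal

variable {𝕜 : Type*} [RCLike 𝕜] {Ω : Type*} [MeasurableSpace Ω] {μ : Measure Ω}
  {Y : Type*} [NormedAddCommGroup Y] [NormedSpace 𝕜 Y]

/-- Two points of a thin slice satisfy `‖y + z‖ ≥ 2 - 2ρ`, so uniform convexity bounds the diameter
of the slice, uniformly in `φ`. -/
lemma UniformConvexSpace.exists_norm_sub_lt_of_re_apply_ge (𝕜 : Type*) [RCLike 𝕜]
    {Y : Type*} [NormedAddCommGroup Y] [NormedSpace 𝕜 Y] [UniformConvexSpace Y] {ε : ℝ}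
    (hε : 0 < ε) :
    ∃ ρ : ℝ, 0 < ρ ∧ ρ < 1 ∧ ∀ φ : Y →L[𝕜] 𝕜, ‖φ‖ ≤ 1 → ∀ y z : Y, ‖y‖ ≤ 1 → ‖z‖ ≤ 1 →
      1 - ρ ≤ RCLike.re (φ y) → 1 - ρ ≤ RCLike.re (φ z) → ‖y - z‖ < ε := by
  let _ : NormedSpace ℝ Y := NormedSpace.restrictScalars ℝ 𝕜 Y
  obtain ⟨δ, hδ, H⟩ := exists_forall_closed_ball_dist_add_le_two_sub Y hε
  refine ⟨min (δ / 4) (1 / 2), by positivity, (min_le_right _ _).trans_lt (by norm_num),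
    fun φ hφ y z hy hz hφy hφz => ?_⟩
  by_contra! h
  have h1 := H hy hz h
  have h2 : RCLike.re (φ y) + RCLike.re (φ z) ≤ ‖y + z‖ := by
    rw [← map_add, ← map_add]
    exact (RCLike.re_le_norm _).trans (by simpa using φ.le_of_opNorm_le hφ (y + z))
  linarith [min_le_left (δ / 4) (1 / 2)]

/-- `ψ` integrates over `A` against the conjugate phase of `x`. -/
lemma exists_functional_sign {x : Lp 𝕜 1 μ} {A : Set Ω} (hA : MeasurableSet A) :
    ∃ ψ : Lp 𝕜 1 μ →L[𝕜] 𝕜, (∀ f, ‖ψ f‖ ≤ ‖L1restrict μ A f‖) ∧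
      (∀ f, ψ (L1restrict μ A f) = ψ f) ∧
      ∀ E, MeasurableSet E → E ⊆ A →
        ψ (L1restrict μ E x) = (‖L1restrict μ E x‖ : 𝕜) := by
  have hxm : Measurable x := (Lp.stronglyMeasurable x).measurable
  obtain ⟨ψ, hψ, hψ'⟩ := exists_functional_mul (μ := μ) hA
    (b := fun ω => starRingEnd 𝕜 (x ω) * ((‖x ω‖⁻¹ : ℝ) : 𝕜))
    ((RCLike.continuous_conj.measurable.comp hxm).mul
      (RCLike.measurable_ofReal.comp hxm.norm.inv)) (fun ω => by
      rw [norm_mul, RCLike.norm_conj, RCLike.norm_ofReal,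
        abs_of_nonneg (inv_nonneg.2 (norm_nonneg _))]
      exact mul_inv_le_one)
  refine ⟨ψ, hψ', fun f => ?_, fun E hE hEA => ?_⟩
  · rw [hψ, hψ]
    refine setIntegral_congr_ae hA ?_
    filter_upwards [coeFn_L1restrict hA f] with ω h hω
    rw [h, Set.indicator_of_mem hω]
  · rw [hψ, norm_L1restrict hE, ← integral_ofReal, ← integral_indicator hA,
      ← integral_indicator hE]
    refine integral_congr_ae ?_
    filter_upwards [coeFn_L1restrict hE x] with ω h
    by_cases hω : ω ∈ E
    · rw [Set.indicator_of_mem (hEA hω), Set.indicator_of_mem hω, h, Set.indicator_of_mem hω]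
      by_cases h0 : x ω = 0
      · simp [h0]
      · have h0' : (‖x ω‖ : 𝕜) ≠ 0 := by exact_mod_cast norm_ne_zero_iff.2 h0
        rw [mul_right_comm, RCLike.conj_mul]
        push_cast
        field_simp
    · by_cases hωA : ω ∈ A <;> simp [hω, hωA, h]

/-- An operator on `L¹` almost attaining its norm at `x` is close, on a set carrying most of the
mass of `x`, to an operator of rank one attaining its norm near `x`. -/
theorem exists_rank_one_approximation [UniformConvexSpace Y] {ε : ℝ} (hε : 0 < ε) :
    ∃ η : ℝ, 0 < η ∧ ∀ T : Lp 𝕜 1 μ →L[𝕜] Y, ‖T‖ ≤ 1 → ∀ x : Lp 𝕜 1 μ, ‖x‖ = 1 → 1 - η < ‖T x‖ →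
      ∃ P Q : Lp 𝕜 1 μ →L[𝕜] Lp 𝕜 1 μ, IsLDecomposition P Q ∧
        ∃ (ψ : Lp 𝕜 1 μ →L[𝕜] 𝕜) (y : Y) (x₀ : Lp 𝕜 1 μ), (∀ f, ‖ψ f‖ ≤ ‖P f‖) ∧ ‖y‖ = 1 ∧
          ‖x₀‖ = 1 ∧ P x₀ = x₀ ∧ ψ x₀ = 1 ∧ (∀ f, ‖T (P f) - ψ f • y‖ ≤ ε * ‖f‖) ∧
          ‖x - x₀‖ < ε := by
  obtain ⟨ρ, hρ, hρ1, hslice⟩ :=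
    UniformConvexSpace.exists_norm_sub_lt_of_re_apply_ge 𝕜 (Y := Y) hε
  obtain ⟨τ, hτ, hτ1, hτε⟩ : ∃ τ : ℝ, 0 < τ ∧ τ < 1 ∧ 2 * τ ≤ ε :=
    ⟨min (ε / 2) (1 / 2), by positivity, (min_le_right _ _).trans_lt (by norm_num), by
      linarith [min_le_left (ε / 2) (1 / 2)]⟩
  -- `ρ` is the slice depth and `τ` bounds the mass of `x` off `A`. Restricting and renormalizing
  -- `x` costs twice that mass, whence `2 * τ ≤ ε`.
  refine ⟨ρ * τ, by positivity, fun T hT x hx hTx => ?_⟩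
  have hT' : ∀ f, ‖T f‖ ≤ ‖f‖ := fun f => by simpa using T.le_of_opNorm_le hT f
  obtain ⟨φ, hφ, hφx⟩ := exists_dual_vector'' 𝕜 (T x)
  have hφT : ‖φ.comp T‖ ≤ 1 :=
    (φ.opNorm_comp_le T).trans (mul_le_one₀ hφ (norm_nonneg _) hT)
  obtain ⟨A, hA, hxA, hAre, hAτ⟩ := exists_set_re_apply_ge_and_norm_gt hx hφT hρ (τ := τ) (by
    rw [ContinuousLinearMap.comp_apply, hφx, RCLike.ofReal_re]
    exact hTx)
  have hdec := isLDecomposition_L1restrict (𝕜 := 𝕜) (μ := μ) hA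
  obtain ⟨ψ, hψP, hψA, hψx⟩ := exists_functional_sign (x := x) hA
  have hPP : ∀ f : Lp 𝕜 1 μ, L1restrict μ A (L1restrict μ A f) = L1restrict μ A f := fun f => by
    rw [L1restrict_L1restrict hA hA, Set.inter_self]
  -- normalized images of restrictions of `x` lie in a slice of the unit ball
  have hz : ∀ E, MeasurableSet E → E ⊆ A → L1restrict μ E x ≠ 0 →
      ‖(‖L1restrict μ E x‖ : 𝕜)⁻¹ • T (L1restrict μ E x)‖ ≤ 1 ∧
      1 - ρ ≤ RCLike.re (φ ((‖L1restrict μ E x‖ : 𝕜)⁻¹ • T (L1restrict μ E x))) := by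
    intro E hE hEA h0
    have hpos : 0 < ‖L1restrict μ E x‖ := norm_pos_iff.2 h0
    constructor
    · rw [norm_smul, norm_inv, RCLike.norm_ofReal, abs_norm, inv_mul_le_iff₀ hpos, mul_one]
      exact hT' _
    · rw [map_smul, smul_eq_mul, ← RCLike.ofReal_inv, RCLike.re_ofReal_mul,
        le_inv_mul_iff₀ hpos, mul_comm]
      exact hAre E hE hEA
  have hm : 0 < ‖L1restrict μ A x‖ := by linarith
  have hm1 : ‖L1restrict μ A x‖ ≤ 1 := by
    linarith [hdec.norm_add_norm x, norm_nonneg (L1restrict μ Aᶜ x)]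
  have hmk : (‖L1restrict μ A x‖ : 𝕜) ≠ 0 := by exact_mod_cast hm.ne'
  obtain ⟨hzA1, hzA2⟩ := hz A hA subset_rfl (norm_pos_iff.1 hm)
  set zA := (‖L1restrict μ A x‖ : 𝕜)⁻¹ • T (L1restrict μ A x) with hzA
  have hzA0 : 0 < ‖zA‖ := by
    have := (RCLike.re_le_norm (φ zA)).trans (φ.le_of_opNorm_le hφ zA)
    linarith
  set y := (‖zA‖ : 𝕜)⁻¹ • zA with hy
  have hy1 : ‖y‖ = 1 := by
    rw [hy, norm_smul, norm_inv, RCLike.norm_ofReal, abs_norm, inv_mul_cancel₀ hzA0.ne']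
  -- Since `‖zA‖ ≤ 1`, normalizing only increases `Re φ`, so `y` stays in the slice.
  have hyre : 1 - ρ ≤ RCLike.re (φ y) := by
    rw [hy, map_smul, smul_eq_mul, ← RCLike.ofReal_inv, RCLike.re_ofReal_mul,
      le_inv_mul_iff₀ hzA0]
    nlinarith
  refine ⟨L1restrict μ A, L1restrict μ Aᶜ, hdec, ψ, y,
    (‖L1restrict μ A x‖ : 𝕜)⁻¹ • L1restrict μ A x, hψP, hy1, ?_, ?_, ?_, fun f => ?_, ?_⟩
  · rw [norm_smul, norm_inv, RCLike.norm_ofReal, abs_norm, inv_mul_cancel₀ hm.ne']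
  · rw [map_smul, hPP]
  · rw [map_smul, hψx A hA subset_rfl, smul_eq_mul, inv_mul_cancel₀ hmk]
  -- On `x 1_E` the difference `T ∘ P - ψ ⊗ y` equals `‖x 1_E‖` times the difference of two points
  -- of the slice.
  · have hU := norm_apply_le_of_norm_apply_restrict_le (Y := Y) hA hxA
      (U := T.comp (L1restrict μ A) - ψ.smulRight y)
      (fun f => by simp [hPP, hψA]) hε.le (fun E hE hEA => by
        have h1 : (T.comp (L1restrict μ A) - ψ.smulRight y) (L1restrict μ E x) =
            T (L1restrict μ E x) - (‖L1restrict μ E x‖ : 𝕜) • y := by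
          rw [sub_apply, ContinuousLinearMap.comp_apply, L1restrict_L1restrict hA hE,
            Set.inter_eq_self_of_subset_right hEA, ContinuousLinearMap.smulRight_apply,
            hψx E hE hEA]
        rw [h1]
        by_cases h0 : L1restrict μ E x = 0
        · simp [h0]
        · have hpos : 0 < ‖L1restrict μ E x‖ := norm_pos_iff.2 h0
          have hk : (‖L1restrict μ E x‖ : 𝕜) ≠ 0 := by exact_mod_cast hpos.ne'
          obtain ⟨h2, h3⟩ := hz E hE hEA h0
          have h4 := hslice φ hφ _ y h2 hy1.le h3 hyre
          have h5 : T (L1restrict μ E x) - (‖L1restrict μ E x‖ : 𝕜) • y =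
              (‖L1restrict μ E x‖ : 𝕜) •
                ((‖L1restrict μ E x‖ : 𝕜)⁻¹ • T (L1restrict μ E x) - y) := by
            rw [smul_sub, smul_inv_smul₀ hk]
          rw [h5, norm_smul, RCLike.norm_ofReal, abs_norm, mul_comm]
          gcongr) f
    simpa using hU
  · have h1 : x - (‖L1restrict μ A x‖ : 𝕜)⁻¹ • L1restrict μ A x =
        L1restrict μ Aᶜ x + ((‖L1restrict μ A x‖ - 1 : ℝ) : 𝕜) •
          ((‖L1restrict μ A x‖ : 𝕜)⁻¹ • L1restrict μ A x) := by
      rw [RCLike.ofReal_sub, sub_smul, smul_inv_smul₀ hmk, RCLike.ofReal_one, one_smul,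
        ← add_sub_assoc, add_comm (L1restrict μ Aᶜ x), hdec.add_apply x]
    have h2 : ‖((‖L1restrict μ A x‖ - 1 : ℝ) : 𝕜) •
        ((‖L1restrict μ A x‖ : 𝕜)⁻¹ • L1restrict μ A x)‖ = 1 - ‖L1restrict μ A x‖ := by
      rw [norm_smul, norm_smul, norm_inv, RCLike.norm_ofReal, RCLike.norm_ofReal, abs_norm,
        inv_mul_cancel₀ hm.ne', mul_one, abs_of_nonpos (by linarith)]
      ring
    rw [h1]
    refine (norm_add_le _ _).trans_lt ?_
    rw [h2]
    linarith [hdec.norm_add_norm x]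

theorem hasBPBpRSE_L1_of_uniformConvexSpace [UniformConvexSpace Y] {M : Set (Lp 𝕜 1 μ →L[𝕜] Y)}
    (hM : IsStableClass M) : HasBPBpRSE M := by
  intro ε hε
  -- `‖S - T‖` is at most `2 * κ`: one `κ` from the rank-one approximation on `A`, one from the
  -- factor `1 - κ` off `A`. The third makes the inequality strict.
  obtain ⟨κ, hκ, hκ1, hκε⟩ : ∃ κ : ℝ, 0 < κ ∧ κ ≤ 1 ∧ 3 * κ ≤ ε :=
    ⟨min (ε / 3) 1, by positivity, min_le_right _ _, by linarith [min_le_left (ε / 3) 1]⟩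
  obtain ⟨η, hη, H⟩ := exists_rank_one_approximation (𝕜 := 𝕜) (μ := μ) (Y := Y) hκ
  refine ⟨min η (ε / 2), by positivity, (min_le_right _ _).trans_lt (by linarith),
    fun T hTM hT x hx hTx => ?_⟩
  obtain ⟨P, Q, hPQ, ψ, y, x₀, hψ, hy, hx₀, hPx, hψx, hU, hxx⟩ := H T hT.le x hx
    (by linarith [min_le_left η (ε / 2)])
  obtain ⟨hS, hS1, hSx⟩ := isRangeStronglyExposing_of_isLDecomposition hPQ hT.le hκ hκ1 hψ hy hx₀
    hPx hψx rfl
  refine ⟨_, hM.smul_comp_add_mem T hTM _ Q ψ y, hS, x₀, hx₀, hS1, hSx, ?_, by linarith⟩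
  refine (ContinuousLinearMap.opNorm_le_bound _ (M := 2 * κ) (by positivity)
    fun f => ?_).trans_lt (by linarith)
  have h1 : (((1 - κ : ℝ) : 𝕜) • T.comp Q + ψ.smulRight y - T) f =
      -(T (P f) - ψ f • y) - (κ : 𝕜) • T (Q f) := by
    have h2 : T f = T (P f) + T (Q f) := by rw [← map_add, hPQ.add_apply]
    simp only [sub_apply, add_apply, smul_apply, ContinuousLinearMap.comp_apply,
      ContinuousLinearMap.smulRight_apply, h2]
    push_cast
    module
  rw [h1]
  refine (norm_sub_le _ _).trans ?_
  rw [norm_neg, norm_smul, RCLike.norm_ofReal, abs_of_pos hκ]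
  have h3 : ‖T (Q f)‖ ≤ ‖f‖ := by
    have := T.le_of_opNorm_le hT.le (Q f)
    linarith [hPQ.norm_add_norm f, norm_nonneg (P f)]
  have h4 := mul_le_mul_of_nonneg_left h3 hκ.le
  linarith [hU f]

end Approximation

theorem mainTheorem11 {𝕜 : Type z} [RCLike 𝕜]
    {Y : Type u} [NormedAddCommGroup Y] [NormedSpace 𝕜 Y] [CompleteSpace Y]
    {Ω : Type v} [MeasurableSpace Ω] (μ : Measure Ω) [SigmaFinite μ]
    (hdim : 2 ≤ Module.rank 𝕜 (Lp 𝕜 1 μ)) :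
    List.TFAE [
      HasBPBpRSE {T : Lp 𝕜 1 μ →L[𝕜] Y | IsFiniteRankOperator T},
      HasBPBpRSE {T : Lp 𝕜 1 μ →L[𝕜] Y | IsCompactOperator T},
      HasBPBpRSE {T : Lp 𝕜 1 μ →L[𝕜] Y | IsWeaklyCompactOperator T},
      HasBPBpRSE {T : Lp 𝕜 1 μ →L[𝕜] Y | IsRadonNikodymOperator.{u, max v z, w, z} T},
      HasBPBpRSE (Set.univ : Set (Lp 𝕜 1 μ →L[𝕜] Y)),
      UniformConvexSpace Y] := by
  have key : ∀ {M : Set (Lp 𝕜 1 μ →L[𝕜] Y)}, IsStableClass M →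
      (HasBPBpRSE M ↔ UniformConvexSpace Y) := fun hM =>
    ⟨uniformConvexSpace_of_hasBPBpRSE_L1 hdim hM, fun _ => hasBPBpRSE_L1_of_uniformConvexSpace hM⟩
  tfae_have 1 ↔ 6 := key isStableClass_isFiniteRankOperator
  tfae_have 2 ↔ 6 := key isStableClass_isCompactOperator
  tfae_have 3 ↔ 6 := key isStableClass_isWeaklyCompactOperator
  tfae_have 4 ↔ 6 := key isStableClass_isRadonNikodymOperator
  tfae_have 5 ↔ 6 := key isStableClass_univ
  tfae_finish
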